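/- Let $p$ be a prime. Write $[a,b]=a^{-1}b^{-1}ab$ and $a^g=g^{-1}ag$ (so $y^{jt^i}=t^{-i}y^jt^i$), and let $$G=\langle x,y,t \mid x^t=x^p,\ y^{t^{-1}}=y^p,\ [x,y]=1,\ [[x,y^{jt^i}],x]=1 \text{ for all } i,j\in\mathbb Z\rangle.$$ For a word $w(x_1,\dots,x_n)$, $n\ge 1$, put $w^{(0)}=w$ and $w^{(j+1)}(x_1,\dots,x_n)=w(w^{(j)}(x_1,\dots,x_n),x_2,\dots,x_n)$. The word $w$ is an iterated identity of a group $\Gamma$ if for all $x_1,\dots,x_n\in\Gamma$ there is $j\ge 0$ with $w^{(j)}(x_1,\dots,x_n)=1$; an iterated identity is bounded if one $j$ works for all $x_1,\dots,x_n\in\Gamma$, and unbounded otherwise. The group $\Gamma$ is bounded if every iterated identity of $\Gamma$ is bounded, and fractal if it satisfies some iterated identity and is not bounded. Then $G$ is a finitely generated solvable group of derived length exactly three, and the word $w(x_1,x_2,x_3)=[x_1,[x_2,x_3]]^p$ is an unbounded iterated identity of $G$; in particular $G$ is fractal. More precisely, for $i\ge 1$ and $x_1=x^{t^{-i}}$,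 $x_2=t^{-1}$, $x_3=(y^{-1})^{t^i}$ one has $w^{(j)}(x_1,x_2,x_3)\ne 1$ for all $j\ge 0$ with $j+1<i$. -/

import Mathlib

namespace IterId

/-- The commutator `[a, b] = a⁻¹ b⁻¹ a b`. -/
def comm {G : Type*} [Group G] (a b : G) : G := a⁻¹ * b⁻¹ * a * b

/-- The conjugate `a ^ g = g⁻¹ a g`. -/
def cj {G : Type*} [Group G] (a g : G) : G := g⁻¹ * a * g

/-- The iterations `w^(j)` of a word on the `n + 1` letters `x 0, …, x n`:
`w^(0)(x) = w(x)`, and `w^(j+1)(x)` is `w` evaluated after replacing the first letter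
by `w^(j)(x)`. -/
def iter {G : Type*} [Group G] {n : ℕ} (w : FreeGroup (Fin (n + 1)))
    (x : Fin (n + 1) → G) : ℕ → G
  | 0 => FreeGroup.lift x w
  | j + 1 => FreeGroup.lift (Function.update x 0 (iter w x j)) w

/-- `w` is an iterated identity of `G`. -/
def IsIteratedIdentity (G : Type*) [Group G] {n : ℕ} (w : FreeGroup (Fin (n + 1))) : Prop :=
  ∀ x : Fin (n + 1) → G, ∃ j : ℕ, iter w x j = 1

/-- Some iteration of `w` is trivial on all of `G` at once. -/
def IsBoundedOn (G : Type*) [Group G] {n : ℕ} (w : FreeGroup (Fin (n + 1))) : Prop :=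
  ∃ j : ℕ, ∀ x : Fin (n + 1) → G, iter w x j = 1

/-- A group is bounded if each of its iterated identities is bounded. -/
def IsBoundedGroup (G : Type*) [Group G] : Prop :=
  ∀ (n : ℕ) (w : FreeGroup (Fin (n + 1))), IsIteratedIdentity G w → IsBoundedOn G w

/-- A group is fractal if it satisfies some iterated identity and is not bounded. -/
def IsFractalGroup (G : Type*) [Group G] : Prop :=
  (∃ (n : ℕ) (w : FreeGroup (Fin (n + 1))), IsIteratedIdentity G w) ∧ ¬ IsBoundedGroup G

/-- `G` is solvable of derived length exactly `n`. -/
def HasDerivedLength (G : Type*) [Group G] (n : ℕ) : Prop :=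
  derivedSeries G n = ⊥ ∧ ∀ m < n, derivedSeries G m ≠ ⊥

/-- The names of the three generators. -/
inductive Gen
  | x
  | y
  | t

/-- The free generators. -/
abbrev fx : FreeGroup Gen := FreeGroup.of Gen.x
/-- The free generators. -/
abbrev fy : FreeGroup Gen := FreeGroup.of Gen.y
/-- The free generators. -/
abbrev ft : FreeGroup Gen := FreeGroup.of Gen.t

/-- The relators of
`⟨x, y, t | x^t = x^p, y^(t⁻¹) = y^p, [x,y] = 1, [[x, (y^j)^(t^i)], x] = 1 (i, j ∈ ℤ)⟩`. -/
def rels (p : ℕ) : Set (FreeGroup Gen) :=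
  {cj fx ft * (fx ^ p)⁻¹, cj fy ft⁻¹ * (fy ^ p)⁻¹, comm fx fy} ∪
    {r | ∃ i j : ℤ, r = comm (comm fx (cj (fy ^ j) (ft ^ i))) fx}

/-- The group `G`. -/
abbrev G (p : ℕ) : Type := PresentedGroup (rels p)

/-- The image of a generator in `G`. -/
def gen (p : ℕ) (s : Gen) : G p := PresentedGroup.of s

/-- The word `w(x₁, x₂, x₃) = [x₁, [x₂, x₃]]^p`. -/
def w (p : ℕ) : FreeGroup (Fin 3) :=
  comm (FreeGroup.of 0) (comm (FreeGroup.of 1) (FreeGroup.of 2)) ^ p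

/-- The triple `x₁ = x^(t^(-i))`, `x₂ = t⁻¹`, `x₃ = (y⁻¹)^(t^i)`. -/
def triple (p i : ℕ) : Fin 3 → G p :=
  ![cj (gen p .x) (gen p .t ^ (-(i : ℤ))), (gen p .t)⁻¹, cj (gen p .y)⁻¹ (gen p .t ^ (i : ℤ))]

end IterId

/-!
The conjugates of `x` by `⟨y ^ (t ^ k) : k ∈ ℤ⟩` and by powers of `t` commute, so the normal
closure `X` of `x` is abelian. The subgroup `Y = ⟨y ^ (t ^ k) : k ∈ ℤ⟩` is an increasing union of
cyclic groups, `G / XY` is cyclic, and `X` contains the second derived subgroup. The second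
iteration of `a ↦ [a, g] ^ p` at `g = [x₂, x₃] ∈ XY` therefore lies in `X`. From there on
`a ↦ [a, g]` is an endomorphism, so each iteration also contributes a `p`-th power. Since
`x ^ (t ^ (k + m)) = (x ^ (t ^ k)) ^ (p ^ m)`, and `x ^ (t ^ k)` commutes with `y ^ (t ^ l)` for
`l ≤ k`, every `a ∈ X` has some `a ^ (p ^ m)` commuting with `g`, and the iterations die out.

How many are needed is read off in the wreath product `(ℚ/ℤ) ≀ Sym(ℤ × ℚ)`, with `y` acting as a
translation of `ℚ`, `t` as the dilation by `p` that also moves the `ℤ`-coordinate, and `x` as the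
function equal to `p ^ s` on `{s} × p ^ s ℤ` and trivial elsewhere. There the iteration becomes a
difference operator multiplied by `p`. At a suitable point of level `s = n - b` only the top term
of the `n`-th difference of the image of `x ^ (t ^ a)` survives, and it gives `p ^ (2 n + a - b)`
modulo `1`.
-/

namespace IterId

section Words

open scoped commutatorElement

variable {H K : Type*} [Group H] [Group K] {a b g : H} {p : ℕ}

theorem map_comm (f : H →* K) (a b : H) : f (comm a b) = comm (f a) (f b) := by
  simp only [comm, map_mul, map_inv]

theorem map_cj (f : H →* K) (a g : H) : f (cj a g) = cj (f a) (f g) := by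
  simp only [cj, map_mul, map_inv]

theorem cj_eq_conj (a g : H) : cj a g = MulAut.conj g⁻¹ a := by simp [cj]

theorem cj_inv (a g : H) : cj a⁻¹ g = (cj a g)⁻¹ := by simp only [cj_eq_conj, map_inv]

theorem cj_pow (a g : H) (n : ℕ) : cj (a ^ n) g = cj a g ^ n := by simp only [cj_eq_conj, map_pow]

theorem cj_zpow (a g : H) (n : ℤ) : cj (a ^ n) g = cj a g ^ n := by
  simp only [cj_eq_conj, map_zpow]

theorem cj_cj (a g h : H) : cj (cj a g) h = cj a (g * h) := by simp [cj, mul_assoc]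

theorem cj_self_distrib (a g h : H) : cj (cj a g) h = cj (cj a h) (cj g h) := by
  simp [cj, mul_assoc]

theorem cj_one (a : H) : cj a 1 = a := by simp [cj]

theorem cj_eq_of_commute (h : Commute a g) : cj a g = a := by
  rw [cj, mul_assoc, h.eq, inv_mul_cancel_left]

theorem commute_cj (h : Commute a b) (g : H) : Commute (cj a g) (cj b g) := by
  simpa only [cj_eq_conj] using h.map (MulAut.conj g⁻¹)

theorem comm_eq_inv_mul_cj (a g : H) : comm a g = a⁻¹ * cj a g := by simp only [comm, cj, mul_assoc]

theorem comm_eq_inv_cj_mul (a g : H) : comm a g = (cj g a)⁻¹ * g := by simp [comm, cj, mul_assoc]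

theorem comm_eq_commutatorElement (a b : H) : comm a b = ⁅a⁻¹, b⁻¹⁆ := by
  simp only [comm, commutatorElement_def, inv_inv]

theorem comm_eq_one_iff_commute : comm a b = 1 ↔ Commute a b := by
  rw [comm_eq_commutatorElement, commutatorElement_eq_one_iff_commute, Commute.inv_inv_iff]

theorem comm_pow_left (h : Commute a (cj a g)) (n : ℕ) : comm a g ^ n = comm (a ^ n) g := by
  rw [comm_eq_inv_mul_cj, comm_eq_inv_mul_cj, cj_pow, h.inv_left.mul_pow, inv_pow]

theorem commute_of_mem_zpowers (h : Commute a b) (hg : g ∈ Subgroup.zpowers b) : Commute a g := by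
  obtain ⟨n, rfl⟩ := hg
  exact h.zpow_right n

/-- The map `a ↦ [a, g]^p`, whose iterates at `g = [x₂, x₃]` are the iterations of `w p`. -/
def commPow (p : ℕ) (g a : H) : H := comm a g ^ p

theorem iter_w (p : ℕ) (v : Fin 3 → H) (j : ℕ) :
    iter (w p) v j = (commPow p (comm (v 1) (v 2)))^[j + 1] (v 0) := by
  induction j with
  | zero => simp [iter, w, map_comm, commPow]
  | succ j ih =>
    rw [Function.iterate_succ_apply', ← ih]
    simp [iter, w, map_comm, commPow]

theorem map_commPow_iterate (f : H →* K) (p : ℕ) (g a : H) (n : ℕ) :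
    f ((commPow p g)^[n] a) = (commPow p (f g))^[n] (f a) :=
  Function.Semiconj.iterate_right (fun a ↦ by rw [commPow, map_pow, map_comm, commPow]) n a

theorem comm_mem_of_normal {A : Subgroup H} [A.Normal] (ha : a ∈ A) (g : H) : comm a g ∈ A := by
  rw [comm_eq_inv_mul_cj, cj_eq_conj]
  exact mul_mem (inv_mem ha) (‹A.Normal›.conj_mem a ha _)

theorem commPow_iterate_eq_one {A : Subgroup H} [A.Normal] [IsMulCommutative A] {m : ℕ}
    (ha : a ∈ A) (hg : Commute (a ^ p ^ m) g) : (commPow p g)^[m + 1] a = 1 := by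
  induction m generalizing a with
  | zero =>
    rw [pow_zero, pow_one, ← comm_eq_one_iff_commute] at hg
    rw [zero_add, Function.iterate_one, commPow, hg, one_pow]
  | succ m ih =>
    have hcj : Commute a (cj a g) :=
      setLike_mul_comm ha (by rw [cj_eq_conj]; exact ‹A.Normal›.conj_mem a ha _)
    have hpow : commPow p g a ^ p ^ m = 1 := by
      rw [commPow, ← pow_mul, ← pow_succ', comm_pow_left hcj, comm_eq_one_iff_commute.2 hg]
    exact ih (pow_mem (comm_mem_of_normal ha g) p) (hpow ▸ Commute.one_left g)

theorem comm_mem_derivedSeries_succ {n : ℕ} (ha : a ∈ derivedSeries H n)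
    (hb : b ∈ derivedSeries H n) : comm a b ∈ derivedSeries H (n + 1) := by
  rw [comm_eq_commutatorElement]
  exact Subgroup.commutator_mem_commutator (inv_mem ha) (inv_mem hb)

theorem comm_mem_derivedSeries_one (a b : H) : comm a b ∈ derivedSeries H 1 :=
  comm_mem_derivedSeries_succ (Subgroup.mem_top a) (Subgroup.mem_top b)

theorem commPow_commPow_comm_mem_derivedSeries_two (p : ℕ) (a b c : H) :
    (commPow p (comm b c))^[2] a ∈ derivedSeries H 2 :=
  pow_mem (comm_mem_derivedSeries_succ (pow_mem (comm_mem_derivedSeries_one a _) p)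
    (comm_mem_derivedSeries_one b c)) p

theorem commutator_sup_self_le {N A : Subgroup H} [N.Normal] [IsMulCommutative A] :
    ⁅N ⊔ A, N ⊔ A⁆ ≤ N := by
  rw [← QuotientGroup.ker_mk' N, ← Subgroup.map_eq_bot_iff, Subgroup.map_commutator,
    Subgroup.map_sup, QuotientGroup.ker_mk', QuotientGroup.map_mk'_self, bot_sup_eq,
    Subgroup.commutator_self_eq_bot_iff]
  infer_instance

end Words

section Structure

open Filter

variable {p : ℕ}

theorem group_fg (p : ℕ) : Group.FG (G p) := by
  have : Finite Gen := Finite.of_surjective (![Gen.x, Gen.y, Gen.t] : Fin 3 → Gen) (by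
    rintro (_ | _ | _)
    exacts [⟨0, rfl⟩, ⟨1, rfl⟩, ⟨2, rfl⟩])
  exact Group.fg_of_surjective (PresentedGroup.mk_surjective (rels p))

theorem cj_gen_x : cj (gen p .x) (gen p .t) = gen p .x ^ p := by
  have h := PresentedGroup.one_of_mem (rels := rels p) (Or.inl (Or.inl rfl))
  rwa [map_mul, map_inv, map_pow, map_cj, mul_inv_eq_one] at h

theorem cj_gen_y : cj (gen p .y) (gen p .t)⁻¹ = gen p .y ^ p := by
  have h := PresentedGroup.one_of_mem (rels := rels p) (Or.inl (Or.inr (Or.inl rfl)))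
  rwa [map_mul, map_inv, map_pow, map_cj, map_inv, mul_inv_eq_one] at h

theorem commute_gen_x_gen_y : Commute (gen p .x) (gen p .y) := by
  have h := PresentedGroup.one_of_mem (rels := rels p) (Or.inl (Or.inr (Or.inr rfl)))
  rwa [map_comm, comm_eq_one_iff_commute] at h

theorem commute_comm_gen_x (i j : ℤ) :
    Commute (comm (gen p .x) (cj (gen p .y ^ j) (gen p .t ^ i))) (gen p .x) := by
  have h := PresentedGroup.one_of_mem (rels := rels p) (Or.inr ⟨i, j, rfl⟩)
  rwa [map_comm, map_comm, map_cj, map_zpow, map_zpow, comm_eq_one_iff_commute] at h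

variable (p) in
/-- The conjugates `x ^ (t ^ k)`. -/
def xt (k : ℤ) : G p := cj (gen p .x) (gen p .t ^ k)

variable (p) in
/-- The conjugates `y ^ (t ^ k)`. -/
def yt (k : ℤ) : G p := cj (gen p .y) (gen p .t ^ k)

theorem cj_xt (k l : ℤ) : cj (xt p k) (gen p .t ^ l) = xt p (k + l) := by
  rw [xt, cj_cj, ← zpow_add, xt]

theorem cj_yt (k l : ℤ) : cj (yt p k) (gen p .t ^ l) = yt p (k + l) := by
  rw [yt, cj_cj, ← zpow_add, yt]

theorem xt_zero : xt p 0 = gen p .x := by rw [xt, zpow_zero, cj_one]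

theorem yt_zero : yt p 0 = gen p .y := by rw [yt, zpow_zero, cj_one]

theorem xt_add_one (k : ℤ) : xt p (k + 1) = xt p k ^ p := by
  rw [xt, add_comm, zpow_one_add, ← cj_cj, cj_gen_x, cj_pow, xt]

theorem yt_sub_one (k : ℤ) : yt p (k - 1) = yt p k ^ p := by
  rw [yt, ← neg_add_eq_sub, zpow_add, zpow_neg_one, ← cj_cj, cj_gen_y, cj_pow, yt]

theorem xt_add_natCast (k : ℤ) (m : ℕ) : xt p (k + m) = xt p k ^ p ^ m := by
  induction m with
  | zero => simp
  | succ m ih => rw [Nat.cast_succ, ← add_assoc, xt_add_one, ih, ← pow_mul, pow_succ]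

theorem antitone_zpowers_xt : Antitone fun k ↦ Subgroup.zpowers (xt p k) :=
  antitone_int_of_succ_le fun k ↦ by
    rw [Subgroup.zpowers_le, xt_add_one]
    exact Subgroup.npow_mem_zpowers _ _

theorem monotone_zpowers_yt : Monotone fun k ↦ Subgroup.zpowers (yt p k) :=
  monotone_int_of_le_succ fun k ↦ by
    rw [Subgroup.zpowers_le, ← add_sub_cancel_right k 1, yt_sub_one, add_sub_cancel_right]
    exact Subgroup.npow_mem_zpowers _ _

theorem commute_xt_yt {k l : ℤ} (h : l ≤ k) : Commute (xt p k) (yt p l) :=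
  commute_of_mem_zpowers (commute_cj commute_gen_x_gen_y _)
    (monotone_zpowers_yt h (Subgroup.mem_zpowers _))

variable (p) in
/-- The subgroup generated by the conjugates of `y` by powers of `t`, written as a directed union
of cyclic subgroups. -/
def ySubgroup : Subgroup (G p) := ⨆ k, Subgroup.zpowers (yt p k)

theorem mem_ySubgroup {u : G p} : u ∈ ySubgroup p ↔ ∃ k, u ∈ Subgroup.zpowers (yt p k) :=
  Subgroup.mem_iSup_of_directed monotone_zpowers_yt.directed_le

theorem yt_mem_ySubgroup (k : ℤ) : yt p k ∈ ySubgroup p :=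
  mem_ySubgroup.2 ⟨k, Subgroup.mem_zpowers _⟩

instance : IsMulCommutative (ySubgroup p) := by
  refine .of_setLike_mul_comm fun a ha b hb ↦ ?_
  obtain ⟨k, ha⟩ := mem_ySubgroup.1 ha
  obtain ⟨l, hb⟩ := mem_ySubgroup.1 hb
  exact setLike_mul_comm (monotone_zpowers_yt (le_max_left k l) ha)
    (monotone_zpowers_yt (le_max_right k l) hb)

theorem cj_mem_ySubgroup {u : G p} (hu : u ∈ ySubgroup p) (l : ℤ) :
    cj u (gen p .t ^ l) ∈ ySubgroup p := by
  obtain ⟨k, n, rfl⟩ := mem_ySubgroup.1 hu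
  simp only [cj_zpow, cj_yt]
  exact zpow_mem (yt_mem_ySubgroup _) n

theorem commute_gen_x_cj_gen_x {u : G p} (hu : u ∈ ySubgroup p) :
    Commute (gen p .x) (cj (gen p .x) u) := by
  obtain ⟨i, j, rfl⟩ := mem_ySubgroup.1 hu
  have h := commute_comm_gen_x (p := p) i j
  rw [cj_zpow, ← yt, comm_eq_inv_mul_cj] at h
  simpa only [mul_inv_cancel_left] using (Commute.refl (gen p .x)).mul_right h.symm

theorem commute_xt_cj_xt_self (k : ℤ) {u : G p} (hu : u ∈ ySubgroup p) :
    Commute (xt p k) (cj (xt p k) u) := by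
  have h := commute_cj (commute_gen_x_cj_gen_x (cj_mem_ySubgroup hu (-k))) (gen p .t ^ k)
  rwa [cj_self_distrib, cj_cj u, ← zpow_add, neg_add_cancel, zpow_zero, cj_one, ← xt] at h

theorem commute_xt_cj_xt (k l : ℤ) {u : G p} (hu : u ∈ ySubgroup p) :
    Commute (xt p k) (cj (xt p l) u) := by
  obtain ⟨r, hr⟩ := antitone_zpowers_xt (p := p) (min_le_left k l) (Subgroup.mem_zpowers _)
  obtain ⟨s, hs⟩ := antitone_zpowers_xt (p := p) (min_le_right k l) (Subgroup.mem_zpowers _)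
  simp only at hr hs
  rw [← hr, ← hs, cj_zpow]
  exact (commute_xt_cj_xt_self _ hu).zpow_zpow r s

variable (p) in
/-- The normal closure of `x`, given by generators that visibly commute with each other. -/
def xSubgroup : Subgroup (G p) :=
  Subgroup.closure {a | ∃ k, ∃ u ∈ ySubgroup p, cj (xt p k) u = a}

theorem cj_xt_mem_xSubgroup (k : ℤ) {u : G p} (hu : u ∈ ySubgroup p) :
    cj (xt p k) u ∈ xSubgroup p :=
  Subgroup.subset_closure ⟨k, u, hu, rfl⟩

instance : IsMulCommutative (xSubgroup p) := by
  refine Subgroup.isMulCommutative_closure ?_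
  rintro _ ⟨k, u, hu, rfl⟩ _ ⟨l, v, hv, rfl⟩
  have h := commute_cj (commute_xt_cj_xt k l (mul_mem hv (inv_mem hu))) u
  rwa [cj_cj, inv_mul_cancel_right] at h

theorem zpowers_gen_t_le_normalizer_ySubgroup :
    Subgroup.zpowers (gen p .t) ≤ Subgroup.normalizer (ySubgroup p : Set (G p)) := by
  rw [Subgroup.le_normalizer_iff]
  rintro _ ⟨k, rfl⟩ u hu
  simpa [cj] using cj_mem_ySubgroup hu (-k)

theorem zpowers_gen_t_le_normalizer_xSubgroup :
    Subgroup.zpowers (gen p .t) ≤ Subgroup.normalizer (xSubgroup p : Set (G p)) := by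
  refine Subgroup.le_normalizer_closure_iff.2 ?_
  rintro _ ⟨l, rfl⟩ _ ⟨k, u, hu, rfl⟩
  have h := cj_xt_mem_xSubgroup (k - l) (cj_mem_ySubgroup hu (-l))
  rw [sub_eq_add_neg, ← cj_xt, ← cj_self_distrib] at h
  change _ ∈ xSubgroup p
  simpa [cj] using h

theorem ySubgroup_le_normalizer_xSubgroup :
    ySubgroup p ≤ Subgroup.normalizer (xSubgroup p : Set (G p)) := by
  refine Subgroup.le_normalizer_closure_iff.2 ?_
  rintro v hv _ ⟨k, u, hu, rfl⟩
  change _ ∈ xSubgroup p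
  simpa [cj, mul_assoc] using cj_xt_mem_xSubgroup k (mul_mem hu (inv_mem hv))

theorem gen_x_mem_xSubgroup : gen p .x ∈ xSubgroup p := by
  simpa only [cj_one, xt_zero] using cj_xt_mem_xSubgroup (p := p) 0 (one_mem _)

theorem gen_y_mem_ySubgroup : gen p .y ∈ ySubgroup p := yt_zero (p := p) ▸ yt_mem_ySubgroup 0

theorem eq_top_of_gen_mem {A : Subgroup (G p)} (hx : gen p .x ∈ A) (hy : gen p .y ∈ A)
    (ht : gen p .t ∈ A) : A = ⊤ :=
  (Subgroup.eq_top_iff' A).2 <| PresentedGroup.generated_by _ A <| by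
    rintro (_ | _ | _)
    exacts [hx, hy, ht]

instance : (xSubgroup p).Normal :=
  Subgroup.normalizer_eq_top_iff.1 <| eq_top_of_gen_mem
    (Subgroup.le_normalizer gen_x_mem_xSubgroup)
    (ySubgroup_le_normalizer_xSubgroup gen_y_mem_ySubgroup)
    (zpowers_gen_t_le_normalizer_xSubgroup (Subgroup.mem_zpowers _))

instance : (xSubgroup p ⊔ ySubgroup p).Normal :=
  Subgroup.normalizer_eq_top_iff.1 <| eq_top_of_gen_mem
    (Subgroup.le_normalizer (Subgroup.mem_sup_left gen_x_mem_xSubgroup))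
    (Subgroup.le_normalizer (Subgroup.mem_sup_right gen_y_mem_ySubgroup))
    (Subgroup.normalizer_inf_normalizer_le_normalizer_sup _ _
      ⟨zpowers_gen_t_le_normalizer_xSubgroup (Subgroup.mem_zpowers _),
        zpowers_gen_t_le_normalizer_ySubgroup (Subgroup.mem_zpowers _)⟩)

theorem derivedSeries_one_le : derivedSeries (G p) 1 ≤ xSubgroup p ⊔ ySubgroup p := by
  have h : (xSubgroup p ⊔ ySubgroup p) ⊔ Subgroup.zpowers (gen p .t) = ⊤ := eq_top_of_gen_mem
    (Subgroup.mem_sup_left (Subgroup.mem_sup_left gen_x_mem_xSubgroup))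
    (Subgroup.mem_sup_left (Subgroup.mem_sup_right gen_y_mem_ySubgroup))
    (Subgroup.mem_sup_right (Subgroup.mem_zpowers _))
  rw [derivedSeries_one]
  exact Subgroup.Normal.commutator_le_of_self_sup_commutative_eq_top h inferInstance

theorem derivedSeries_two_le : derivedSeries (G p) 2 ≤ xSubgroup p :=
  (Subgroup.commutator_mono derivedSeries_one_le derivedSeries_one_le).trans
    commutator_sup_self_le

theorem derivedSeries_three : derivedSeries (G p) 3 = ⊥ :=
  eq_bot_iff.2 <| (Subgroup.commutator_mono derivedSeries_two_le derivedSeries_two_le).trans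
    (Subgroup.commutator_self_eq_bot_iff.2 inferInstance).le

theorem commute_cj_xt_pow {k l : ℤ} {u v : G p} (hu : u ∈ ySubgroup p)
    (hv : v ∈ Subgroup.zpowers (yt p l)) {m : ℕ} (hm : l - k ≤ m) :
    Commute (cj (xt p k) u ^ p ^ m) v := by
  have h : Commute (xt p (k + m)) v :=
    commute_of_mem_zpowers (commute_xt_yt (sub_le_iff_le_add'.1 hm)) hv
  have hvu : Commute v u := setLike_mul_comm (mem_ySubgroup.2 ⟨l, hv⟩) hu
  rw [← cj_pow, ← xt_add_natCast, ← cj_eq_of_commute hvu]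
  exact commute_cj h u

theorem eventually_commute_pow {a g : G p} (ha : a ∈ xSubgroup p)
    (hg : g ∈ xSubgroup p ⊔ ySubgroup p) : ∀ᶠ m in atTop, Commute (a ^ p ^ m) g := by
  obtain ⟨b, hb, v, hv, rfl⟩ := Subgroup.mem_sup_of_normal_left.1 hg
  suffices h : ∀ᶠ m in atTop, Commute (a ^ p ^ m) v from
    h.mono fun m hm ↦ Commute.mul_right (setLike_mul_comm (pow_mem ha _) hb) hm
  induction ha using Subgroup.closure_induction with
  | mem a ha =>
    obtain ⟨k, u, hu, rfl⟩ := ha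
    obtain ⟨l, hl⟩ := mem_ySubgroup.1 hv
    filter_upwards [eventually_ge_atTop (l - k).toNat] with m hm
    exact commute_cj_xt_pow hu hl (Int.toNat_le.1 hm)
  | one => exact .of_forall fun m ↦ by rw [one_pow]; exact Commute.one_left v
  | mul a b ha hb iha ihb =>
    filter_upwards [iha, ihb] with m hma hmb
    rw [(show Commute a b from setLike_mul_comm (s := xSubgroup p) ha hb).mul_pow]
    exact hma.mul_left hmb
  | inv a _ ih => exact ih.mono fun m hm ↦ by rw [inv_pow]; exact hm.inv_left

theorem isIteratedIdentity_w (p : ℕ) : IsIteratedIdentity (G p) (w p) := by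
  intro v
  set g := comm (v 1) (v 2)
  have ha : (commPow p g)^[2] (v 0) ∈ xSubgroup p :=
    derivedSeries_two_le (commPow_commPow_comm_mem_derivedSeries_two p _ _ _)
  have hg : g ∈ xSubgroup p ⊔ ySubgroup p := derivedSeries_one_le (comm_mem_derivedSeries_one _ _)
  obtain ⟨m, hm⟩ := (eventually_commute_pow ha hg).exists
  refine ⟨m + 2, ?_⟩
  rw [iter_w, show m + 2 + 1 = (m + 1) + 2 from rfl, Function.iterate_add_apply]
  exact commPow_iterate_eq_one ha hm

end Structure

section Wreath

open SemidirectProduct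

variable {Γ B M : Type*} [Group Γ] [MulAction Γ B] [CommGroup M]

variable (Γ B M) in
/-- The unrestricted permutational wreath product `M ≀_B Γ`. -/
abbrev Wreath : Type _ := (B → M) ⋊[(mulAutArrow : Γ →* MulAut (B → M))] Γ

theorem cj_inl_inr (f : B → M) (σ : Γ) :
    cj (inl f : Wreath Γ B M) (inr σ) = inl fun b ↦ f (σ • b) := by
  rw [cj, ← map_inv, ← inl_aut_inv, ← map_inv]
  congr 1
  ext b
  change f (σ⁻¹⁻¹ • b) = f (σ • b)
  rw [inv_inv]

theorem comm_inl_inr (f : B → M) (σ : Γ) :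
    comm (inl f : Wreath Γ B M) (inr σ) = inl fun b ↦ f (σ • b) / f b := by
  rw [comm_eq_inv_mul_cj, cj_inl_inr, ← map_inv, ← map_mul]
  congr 1
  ext b
  exact inv_mul_eq_div _ _

/-- The action of `commPow p σ` on the base group of a wreath product. -/
def shiftDiff (p : ℕ) (σ : Γ) (f : B → M) : B → M := fun b ↦ (f (σ • b) / f b) ^ p

theorem commPow_iterate_inl (p : ℕ) (σ : Γ) (f : B → M) (n : ℕ) :
    (commPow p (inr σ : Wreath Γ B M))^[n] (inl f) = inl ((shiftDiff p σ)^[n] f) := by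
  have h : Function.Semiconj (inl : (B → M) → Wreath Γ B M) (shiftDiff p σ) (commPow p (inr σ)) :=
    fun f ↦ by rw [commPow, comm_inl_inr, ← map_pow]; rfl
  exact (h.iterate_right n f).symm

theorem shiftDiff_iterate_apply {p n : ℕ} {σ : Γ} {f : B → M} {b : B}
    (h : ∀ k < n, f (σ ^ k • b) = 1) :
    (shiftDiff p σ)^[n] f b = f (σ ^ n • b) ^ p ^ n := by
  induction n generalizing b with
  | zero => simp
  | succ n ih =>
    have hσ (k : ℕ) : σ ^ k • σ • b = σ ^ (k + 1) • b := by rw [smul_smul, pow_succ]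
    rw [Function.iterate_succ_apply', shiftDiff, ih fun k hk ↦ h k (hk.trans n.lt_succ_self),
      ih fun k hk ↦ by rw [hσ]; exact h _ (Nat.succ_lt_succ hk), h n n.lt_succ_self, one_pow,
      div_one, hσ, ← pow_mul, ← pow_succ]

end Wreath

section Model

open Multiplicative (ofAdd)
open SemidirectProduct

/-- The translations `(s, z) ↦ (s, z + c)` of `ℤ × ℚ`. -/
def translation : Multiplicative ℚ →* Equiv.Perm (ℤ × ℚ) where
  toFun c := (Equiv.refl ℤ).prodCongr (Equiv.addRight c.toAdd)
  map_one' := by ext <;> simp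
  map_mul' c d := by ext <;> simp [add_assoc, add_comm c.toAdd]

theorem translation_apply (c : ℚ) (s : ℤ) (z : ℚ) :
    translation (ofAdd c) (s, z) = (s, z + c) := rfl

theorem translation_zpow (c : ℚ) (n : ℤ) :
    translation (ofAdd c) ^ n = translation (ofAdd (n * c)) := by
  rw [← map_zpow, ← ofAdd_zsmul, zsmul_eq_mul]

variable (p : ℕ)

open Classical in
/-- The function with value `p ^ (s + k)` modulo `1` on the points `(s, z)` with `z ∈ p ^ s ℤ`,
and trivial elsewhere; it is the image of `x ^ (t ^ k)` in the model. -/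
noncomputable def bump (k : ℤ) (b : ℤ × ℚ) : Multiplicative (AddCircle (1 : ℚ)) :=
  if b.2 ∈ AddSubgroup.zmultiples ((p : ℚ) ^ b.1) then
    ofAdd (((p : ℚ) ^ (b.1 + k) : ℚ) : AddCircle (1 : ℚ)) else 1

theorem bump_apply_zero (k s : ℤ) :
    bump p k (s, 0) = ofAdd (((p : ℚ) ^ (s + k) : ℚ) : AddCircle (1 : ℚ)) :=
  if_pos (zero_mem _)

variable {p} in
theorem bump_apply_eq_one (hp : 1 < p) {l n : ℕ} (hl : 0 < l) (hln : l ≤ n) (k b : ℤ) :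
    bump p k (n - b, -(l * ((p - 1) * (p : ℚ) ^ (-b)))) = 1 := by
  refine if_neg ?_
  rintro ⟨m, hm⟩
  have hp₀ : (p : ℚ) ≠ 0 := by positivity
  have hmul : (l : ℚ) * (p - 1) = p ^ n * -m := by
    refine mul_right_cancel₀ (zpow_ne_zero (-b) hp₀) ?_
    simp only [sub_eq_add_neg (n : ℤ), zpow_add₀ hp₀, zpow_natCast, zsmul_eq_mul] at hm
    linear_combination hm
  have hdvd : (p : ℤ) ^ n ∣ l * (p - 1) := ⟨-m, by exact_mod_cast hmul⟩
  have hcop : IsCoprime ((p : ℤ) ^ n) (p - 1) := IsCoprime.pow_left ⟨1, -1, by ring⟩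
  have hle : p ^ n ≤ l := Nat.le_of_dvd hl (by exact_mod_cast hcop.dvd_of_dvd_mul_right hdvd)
  exact (hln.trans_lt (Nat.lt_pow_self hp)).not_ge hle

variable [NeZero p]

/-- The dilation `(s, z) ↦ (s + 1, p z)` of `ℤ × ℚ`. -/
def dilation : Equiv.Perm (ℤ × ℚ) :=
  (Equiv.addRight 1).prodCongr (Equiv.mulLeft₀ (p : ℚ) (NeZero.ne _))

theorem dilation_zpow_apply (k s : ℤ) (z : ℚ) :
    (dilation p ^ k) (s, z) = (s + k, (p : ℚ) ^ k * z) := by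
  have hp : (p : ℚ) ≠ 0 := NeZero.ne _
  induction k generalizing s z with
  | zero => simp
  | succ k ih =>
    rw [zpow_add_one, Equiv.Perm.mul_apply]
    change (dilation p ^ (k : ℤ)) (s + 1, p * z) = _
    rw [ih, zpow_add_one₀ hp, mul_assoc, add_right_comm, add_assoc]
  | pred k ih =>
    rw [zpow_sub_one, Equiv.Perm.mul_apply]
    change (dilation p ^ (-k : ℤ)) (s - 1, (p : ℚ)⁻¹ * z) = _
    rw [ih, zpow_sub_one₀ hp, mul_assoc, sub_add_eq_add_sub, add_sub_assoc]

theorem cj_translation_dilation_zpow (c : ℚ) (k : ℤ) :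
    cj (translation (ofAdd c)) (dilation p ^ k) = translation (ofAdd ((p : ℚ) ^ (-k) * c)) := by
  have hp : (p : ℚ) ^ k ≠ 0 := zpow_ne_zero k (NeZero.ne _)
  rw [cj, mul_assoc, inv_mul_eq_iff_eq_mul]
  ext1 ⟨s, z⟩
  simp only [Equiv.Perm.mul_apply, dilation_zpow_apply, translation_apply, zpow_neg, mul_add,
    mul_inv_cancel_left₀ hp]

theorem bump_add_one (k : ℤ) : bump p (k + 1) = bump p k ^ p := by
  ext b
  simp only [bump, Pi.pow_apply, ite_pow, one_pow, ← ofAdd_nsmul, ← AddCircle.coe_nsmul,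
    nsmul_eq_mul, ← add_assoc, zpow_add_one₀ (NeZero.ne (p : ℚ)), mul_comm]

theorem bump_dilation_zpow (k l : ℤ) (b : ℤ × ℚ) :
    bump p k ((dilation p ^ l) b) = bump p (k + l) b := by
  obtain ⟨s, z⟩ := b
  have hp : (p : ℚ) ≠ 0 := NeZero.ne _
  have hmem : (p : ℚ) ^ l * z ∈ AddSubgroup.zmultiples ((p : ℚ) ^ (s + l)) ↔
      z ∈ AddSubgroup.zmultiples ((p : ℚ) ^ s) := by
    simp only [AddSubgroup.mem_zmultiples_iff, add_comm s, zpow_add₀ hp, ← mul_smul_comm,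
      mul_right_inj' (zpow_ne_zero l hp)]
  simp only [dilation_zpow_apply, bump, hmem, add_assoc, add_comm l]

theorem bump_zero_translation_one (b : ℤ × ℚ) :
    bump p 0 (translation (ofAdd 1) b) = bump p 0 b := by
  obtain ⟨s, z⟩ := b
  rw [translation_apply]
  obtain ⟨n, rfl | rfl⟩ := s.eq_nat_or_neg
  · have h : (((p : ℚ) ^ ((n : ℤ) + 0) : ℚ) : AddCircle (1 : ℚ)) = 0 :=
      (AddCircle.coe_eq_zero_iff _).2 ⟨p ^ n, by simp⟩
    simp only [bump, h, ofAdd_zero, ite_self]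
  · have h : (1 : ℚ) ∈ AddSubgroup.zmultiples ((p : ℚ) ^ (-n : ℤ)) :=
      ⟨p ^ n, by simp [NeZero.ne p]⟩
    simp only [bump, AddSubgroup.add_mem_cancel_right _ h]

/-- The wreath product `(ℚ/ℤ) ≀ Sym(ℤ × ℚ)`, which receives a quotient of `G p` large enough to
detect the iterations of `w p`. -/
abbrev Model : Type := Wreath (Equiv.Perm (ℤ × ℚ)) (ℤ × ℚ) (Multiplicative (AddCircle (1 : ℚ)))

/-- The images of the generators of `G p` in the model. -/
noncomputable def modelGen : Gen → Model
  | .x => inl (bump p 0)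
  | .y => inr (translation (ofAdd 1))
  | .t => inr (dilation p)

theorem cj_inl_bump (k l : ℤ) :
    cj (inl (bump p k) : Model) (inr (dilation p) ^ l) = inl (bump p (k + l)) := by
  rw [← map_zpow, cj_inl_inr]
  simp only [Equiv.Perm.smul_def, bump_dilation_zpow]

theorem cj_inr_translation (c : ℚ) (k : ℤ) :
    cj (inr (translation (ofAdd c)) : Model) (inr (dilation p) ^ k) =
      inr (translation (ofAdd ((p : ℚ) ^ (-k) * c))) := by
  rw [← map_zpow, ← map_cj, cj_translation_dilation_zpow]

theorem lift_modelGen_rels : ∀ r ∈ rels p, FreeGroup.lift (modelGen p) r = 1 := by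
  rintro r ((rfl | rfl | rfl) | ⟨i, j, rfl⟩)
  · have h := cj_inl_bump p 0 1
    rw [zpow_one, bump_add_one, map_pow] at h
    simp [map_cj, modelGen, h]
  · have h := cj_inr_translation p 1 (-1)
    rw [zpow_neg_one, neg_neg, zpow_one, ← Int.cast_natCast p, ← translation_zpow, map_zpow,
      zpow_natCast] at h
    simp [map_cj, modelGen, h]
  · simp only [map_comm, FreeGroup.lift_apply_of, modelGen, comm_inl_inr, Equiv.Perm.smul_def,
      bump_zero_translation_one, div_self']
    exact map_one inl
  · simp only [map_comm, map_cj, map_zpow, FreeGroup.lift_apply_of, modelGen]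
    rw [← map_zpow inr (translation _), ← map_zpow inr (dilation p), ← map_cj, comm_inl_inr,
      comm_eq_one_iff_commute]
    exact (Commute.all _ _).map inl

/-- The homomorphism to the model determined by `modelGen`. -/
noncomputable def toModel : G p →* Model := PresentedGroup.toGroup (lift_modelGen_rels p)

theorem toModel_xt (k : ℤ) : toModel p (xt p k) = inl (bump p k) := by
  rw [xt, map_cj, map_zpow, gen, gen, toModel, PresentedGroup.toGroup.of,
    PresentedGroup.toGroup.of, modelGen, modelGen, cj_inl_bump, zero_add]

theorem toModel_yt_zpow (k n : ℤ) :
    toModel p (yt p k ^ n) = inr (translation (ofAdd (n * (p : ℚ) ^ (-k)))) := by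
  rw [map_zpow, yt, map_cj, map_zpow, gen, gen, toModel, PresentedGroup.toGroup.of,
    PresentedGroup.toGroup.of, modelGen, modelGen, cj_inr_translation, mul_one, ← map_zpow,
    translation_zpow]

end Model

section Unbounded

open Multiplicative (ofAdd)
open SemidirectProduct

variable {p : ℕ}

theorem coe_zpow_ne_zero_of_neg (hp : 1 < p) {k : ℤ} (hk : k < 0) :
    (((p : ℚ) ^ k : ℚ) : AddCircle (1 : ℚ)) ≠ 0 := by
  have : Fact ((0 : ℚ) < 1) := ⟨one_pos⟩
  have hp' : (1 : ℚ) < p := mod_cast hp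
  have hpos : 0 < (p : ℚ) ^ k := zpow_pos (one_pos.trans hp') k
  have hlt : (p : ℚ) ^ k < 1 := zpow_lt_one_of_neg₀ hp' hk
  rw [Ne, AddCircle.coe_eq_zero_iff_of_mem_Ico ⟨hpos.le, hlt⟩]
  exact hpos.ne'

theorem commPow_iterate_xt_ne_one (hp : 1 < p) {a b : ℤ} {n : ℕ} (h : 2 * n < b - a) :
    (commPow p (yt p b ^ ((p : ℤ) - 1)))^[n] (xt p a) ≠ 1 := by
  intro hone
  have : NeZero p := ⟨by omega⟩
  set c : ℚ := (p - 1) * (p : ℚ) ^ (-b) with hc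
  have hpow (k : ℕ) :
      translation (ofAdd c) ^ k • ((n - b : ℤ), -(n * c)) = (n - b, (k - n) * c) := by
    rw [← zpow_natCast, translation_zpow, Equiv.Perm.smul_def, translation_apply]
    congr 1
    push_cast
    ring
  have hvanish : ∀ k < n, bump p a (translation (ofAdd c) ^ k • ((n - b : ℤ), -(n * c))) = 1 := by
    intro k hk
    rw [hpow, ← bump_apply_eq_one hp (Nat.sub_pos_of_lt hk) (Nat.sub_le n k) a b, ← hc,
      Nat.cast_sub hk.le]
    congr 2
    ring
  have hmodel := congrArg (toModel p) hone
  rw [map_commPow_iterate, toModel_xt, toModel_yt_zpow, map_one, ← map_one inl,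
    Int.cast_sub, Int.cast_natCast, Int.cast_one, ← hc, commPow_iterate_inl, inl_inj] at hmodel
  have hvalue := (shiftDiff_iterate_apply hvanish).symm.trans (congrFun hmodel _)
  rw [hpow, sub_self, zero_mul, bump_apply_zero, Pi.one_apply, ← ofAdd_nsmul, ofAdd_eq_one,
    ← AddCircle.coe_nsmul, nsmul_eq_mul, Nat.cast_pow, ← zpow_natCast,
    ← zpow_add₀ (NeZero.ne _)] at hvalue
  exact coe_zpow_ne_zero_of_neg hp (by omega) hvalue

theorem comm_triple (p i : ℕ) :
    comm (triple p i 1) (triple p i 2) = yt p i ^ ((p : ℤ) - 1) := by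
  have hcj : cj (yt p i) (gen p .t)⁻¹ = yt p i ^ (p : ℤ) := by
    rw [← zpow_neg_one, cj_yt, ← sub_eq_add_neg, yt_sub_one, zpow_natCast]
  change comm (gen p .t)⁻¹ (cj (gen p .y)⁻¹ (gen p .t ^ (i : ℤ))) = _
  rw [comm_eq_inv_cj_mul, cj_inv, ← yt, cj_inv, hcj, inv_inv, zpow_sub_one]

theorem iter_triple_ne_one (hp : 1 < p) {i j : ℕ} (hij : j + 1 < i) :
    iter (w p) (triple p i) j ≠ 1 := by
  rw [iter_w, comm_triple]
  exact commPow_iterate_xt_ne_one hp (by push_cast; omega)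

theorem not_isBoundedOn_w (hp : 1 < p) : ¬ IsBoundedOn (G p) (w p) := by
  rintro ⟨j, hj⟩
  exact iter_triple_ne_one hp (Nat.lt_succ_self (j + 1)) (hj (triple p (j + 2)))

theorem derivedSeries_two_ne_bot (hp : 1 < p) : derivedSeries (G p) 2 ≠ ⊥ := by
  intro h
  have hmem : iter (w p) (triple p 3) 1 ∈ derivedSeries (G p) 2 := by
    rw [iter_w]
    exact commPow_commPow_comm_mem_derivedSeries_two p _ _ _
  rw [h, Subgroup.mem_bot] at hmem
  exact iter_triple_ne_one hp (by norm_num) hmem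

theorem hasDerivedLength_three (hp : 1 < p) : HasDerivedLength (G p) 3 :=
  ⟨derivedSeries_three, fun _ hm h ↦ derivedSeries_two_ne_bot hp <|
    eq_bot_mono (derivedSeries_antitone _ (Nat.le_of_lt_succ hm)) h⟩

theorem isFractalGroup (hp : 1 < p) : IsFractalGroup (G p) :=
  ⟨⟨2, w p, isIteratedIdentity_w p⟩,
    fun h ↦ not_isBoundedOn_w hp (h 2 (w p) (isIteratedIdentity_w p))⟩

end Unbounded

end IterId

theorem theorem1_general (p : ℕ) (hp : 1 < p) :
    Group.FG (IterId.G p) ∧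
    Group.IsSolvable (IterId.G p) ∧
    IterId.HasDerivedLength (IterId.G p) 3 ∧
    IterId.IsIteratedIdentity (IterId.G p) (IterId.w p) ∧
    ¬ IterId.IsBoundedOn (IterId.G p) (IterId.w p) ∧
    IterId.IsFractalGroup (IterId.G p) ∧
    (∀ i j : ℕ, j + 1 < i → IterId.iter (IterId.w p) (IterId.triple p i) j ≠ 1) :=
  ⟨IterId.group_fg p,
    ⟨3, IterId.derivedSeries_three⟩,
    IterId.hasDerivedLength_three hp,
    IterId.isIteratedIdentity_w p,
    IterId.not_isBoundedOn_w hp,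
    IterId.isFractalGroup hp,
    fun _ _ hij ↦ IterId.iter_triple_ne_one hp hij⟩

theorem theorem1 (p : ℕ) (hp : p.Prime) :
    Group.FG (IterId.G p) ∧
    Group.IsSolvable (IterId.G p) ∧
    IterId.HasDerivedLength (IterId.G p) 3 ∧
    IterId.IsIteratedIdentity (IterId.G p) (IterId.w p) ∧
    ¬ IterId.IsBoundedOn (IterId.G p) (IterId.w p) ∧
    IterId.IsFractalGroup (IterId.G p) ∧
    (∀ i j : ℕ, j + 1 < i → IterId.iter (IterId.w p) (IterId.triple p i) j ≠ 1) :=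
  theorem1_general p hp.one_lt
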